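/- Let $G$ be a countable group and let $\mu$ be a probability measure on $G$ whose support generates $G$ as a semigroup. Let $\pi$ be a unitary (i.e. orthogonal) representation of $G$ on a separable real Hilbert space $\mathcal{H}$, and let $B_1$ be the closed unit ball of $\mathcal{H}$, endowed with the weak topology, its Borel $\sigma$-algebra, and the $G$-action $gu=\pi(g)u$. Let $\xi$ be a Borel probability measure on $B_1$ which is $\mu$-stationary, i.e. $$\sum_{s\in G}\mu(s)\int_{B_1} f(su)\,d\xi(u)=\int_{B_1} f\,d\xi\quad\text{for every bounded Borel function } f:B_1\to\mathbb{R}.$$ (i) Then $\xi$ is $G$-invariant. (ii) Suppose in addition that $\xi$ is ergodic (every Borel set $B\subset B_1$ with $\xi(B\,\Delta\, gB)=0$ for all $g\in G$ is $\xi$-null or $\xi$-conull) and that the map $(u,v)\mapsto\langle u,v\rangle$ on $B_1\times B_1$ is not $\xi\otimes\xi$-almost everywhere equal to a constant. Then $(B_1,\xi)$ has a non-trivial isometric factor. Here a $G$-space is a standard Borel probability space with an action of $G$ by Borel automorphisms which preserve the class of null sets; a factor of $(B_1,\xi)$ is a $G$-space $(W,m)$ with a $G$-equivariant Borel map $p:X'\to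 W$, defined on a $G$-invariant $\xi$-conull Borel set $X'\subset B_1$, such that $p_*\xi=m$; it is non-trivial if $m$ is not a point mass. A $G$-space is isometric if it is isomorphic to $(K/L,m_{K/L})$ with the action $g\,kL=\tau(g)kL$, for some compact second countable Hausdorff group $K$, closed subgroup $L<K$ and homomorphism $\tau:G\to K$ with dense image, where $m_{K/L}$ is the Haar probability measure on $K/L$; isomorphic means that there is a $G$-equivariant, measure-preserving Borel isomorphism between $G$-invariant conull Borel subsets. -/

import Mathlib

open MeasureTheory Set Topology

noncomputable section

namespace StationaryBall

universe u v w

/-! ## Measured groups and `G`-spaces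

An action of `G` on `X` is written as a homomorphism `α : G →* Equiv.Perm X`. -/

section Spaces

variable {G : Type u} [Group G] {X : Type v} [MeasurableSpace X] {W : Type w} [MeasurableSpace W]

/-- `(G, μ)` is a measured group: `G` is countable and the support of the probability measure `μ`
generates `G` as a semigroup. -/
structure IsMeasuredGroup (μ : PMF G) : Prop where
  countable : Countable G
  generates : Subsemigroup.closure μ.support = ⊤

/-- `G` acts on the probability space `(X, ν)` by measurable maps (with measurable inverses, since
this holds for all group elements) which preserve the class of `ν`-null sets. -/
structure IsGSpace (α : G →* Equiv.Perm X) (ν : Measure X) : Prop where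
  isProbabilityMeasure : IsProbabilityMeasure ν
  measurable : ∀ g, Measurable (α g)
  null_iff : ∀ g (A : Set X), MeasurableSet A → (ν (α g ⁻¹' A) = 0 ↔ ν A = 0)

/-- `ν` is `μ`-stationary. Bounded measurable functions represent all classes in `L^∞`. -/
def IsStationary (μ : PMF G) (α : G →* Equiv.Perm X) (ν : Measure X) : Prop :=
  ∀ f : X → ℝ, Measurable f → (∃ C : ℝ, ∀ x, |f x| ≤ C) →
    HasSum (fun s : G => (∫ x, f (α s x) ∂ν) * (μ s).toReal) (∫ x, f x ∂ν)

/-- `ν` is `G`-invariant. -/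
def IsInvariant (α : G →* Equiv.Perm X) (ν : Measure X) : Prop :=
  ∀ g, ν.map (α g) = ν

/-- The action is ergodic: every Borel set which agrees with all its translates up to null sets is
null or conull. -/
def IsErgodic (α : G →* Equiv.Perm X) (ν : Measure X) : Prop :=
  ∀ B : Set X, MeasurableSet B → (∀ g, ν (symmDiff B (α g '' B)) = 0) → ν B = 0 ∨ ν Bᶜ = 0

/-- A factor map from `(X, ν)` to `(W, m)`: a `G`-equivariant Borel map, defined on a `G`-invariant
conull Borel subset of `X`, which pushes `ν` to `m`. -/
structure FactorMap (α : G →* Equiv.Perm X) (ν : Measure X)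
    (β : G →* Equiv.Perm W) (m : Measure W) where
  dom : Set X
  measurableSet_dom : MeasurableSet dom
  invariant : ∀ g, ∀ x ∈ dom, α g x ∈ dom
  conull : ν domᶜ = 0
  toFun : dom → W
  measurable : Measurable toFun
  equivariant : ∀ g (x : dom), toFun ⟨α g x, invariant g x x.2⟩ = β g (toFun x)
  measure_preimage : ∀ A : Set W, MeasurableSet A → ν (Subtype.val '' (toFun ⁻¹' A)) = m A

/-- `(X, ν)` and `(W, m)` are isomorphic: there are factor maps in both directions which are
inverse to each other on their (invariant, conull) domains. -/
def Isomorphic (α : G →* Equiv.Perm X) (ν : Measure X)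
    (β : G →* Equiv.Perm W) (m : Measure W) : Prop :=
  ∃ (p : FactorMap α ν β m) (q : FactorMap β m α ν),
    (∀ x : p.dom, ∃ h : p.toFun x ∈ q.dom, q.toFun ⟨p.toFun x, h⟩ = x) ∧
    (∀ w : q.dom, ∃ h : q.toFun w ∈ p.dom, p.toFun ⟨q.toFun w, h⟩ = w)

end Spaces

/-! ## Isometric `G`-spaces -/

/-- The action `g • kL = τ(g)kL` of `G` on `K ⧸ L`. -/
def cosetAction {G : Type u} [Group G] {K : Type v} [Group K] (τ : G →* K) (L : Subgroup K) :
    G →* Equiv.Perm (K ⧸ L) :=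
  (MulAction.toPermHom K (K ⧸ L)).comp τ

/-- The Haar probability measure on `K ⧸ L`: the image of the Haar probability measure of the
compact group `K`. The `σ`-algebra on `K ⧸ L` is the quotient one, which is the Borel
`σ`-algebra if `K` is compact, Hausdorff and second countable and `L` is closed. -/
def cosetMeasure {K : Type v} [Group K] [TopologicalSpace K] [IsTopologicalGroup K] [CompactSpace K]
    [MeasurableSpace K] [BorelSpace K] (L : Subgroup K) : Measure (K ⧸ L) :=
  (Measure.haarMeasure (⊤ : TopologicalSpace.PositiveCompacts K)).map (fun k : K => (k : K ⧸ L))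

/-- `(W, m)` is isometric: it is isomorphic to some `(K ⧸ L, m_{K/L})`, with `K` a compact
(Hausdorff) second countable group, `L` a closed subgroup and `τ : G → K` a homomorphism with dense
image. Such a `K` has at most continuum many elements, so it may be taken in `Type`. -/
def IsIsometric {G : Type u} [Group G] {W : Type w} [MeasurableSpace W]
    (β : G →* Equiv.Perm W) (m : Measure W) : Prop :=
  ∃ (K : Type) (_ : Group K) (_ : TopologicalSpace K) (_ : IsTopologicalGroup K)
    (_ : CompactSpace K) (_ : T2Space K) (_ : SecondCountableTopology K)
    (_ : MeasurableSpace K) (_ : BorelSpace K) (L : Subgroup K) (τ : G →* K),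
    IsClosed (L : Set K) ∧ DenseRange τ ∧ Isomorphic β m (cosetAction τ L) (cosetMeasure L)

/-- `(X, ν)` admits a factor which is an isometric `G`-space and is non-trivial, i.e. whose measure
is not a point mass. -/
def HasNontrivialIsometricFactor {G : Type u} [Group G] {X : Type v} [MeasurableSpace X]
    (α : G →* Equiv.Perm X) (ν : Measure X) : Prop :=
  ∃ (W : Type) (_ : MeasurableSpace W) (_ : StandardBorelSpace W)
    (β : G →* Equiv.Perm W) (m : Measure W),
    IsGSpace β m ∧ Nonempty (FactorMap α ν β m) ∧ IsIsometric β m ∧ ¬ ∃ w, m = Measure.dirac w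

/-! ## The unit ball of a real Hilbert space with the weak topology -/

section Ball

variable (H : Type v) [NormedAddCommGroup H] [InnerProductSpace ℝ H]

/-- The closed unit ball of `H`, as a subset of `H` with its weak topology. -/
def WeakBall : Type v :=
  {x : WeakSpace ℝ H // (toWeakSpace ℝ H).symm x ∈ Metric.closedBall (0 : H) 1}

instance : TopologicalSpace (WeakBall H) :=
  inferInstanceAs (TopologicalSpace
    {x : WeakSpace ℝ H // (toWeakSpace ℝ H).symm x ∈ Metric.closedBall (0 : H) 1})

/-- The Borel `σ`-algebra of the weak topology. -/
instance : MeasurableSpace (WeakBall H) := borel (WeakBall H)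

instance : BorelSpace (WeakBall H) := ⟨rfl⟩

variable {H}

/-- The vector of `H` underlying a point of the ball. -/
def WeakBall.vec (x : WeakBall H) : H := (toWeakSpace ℝ H).symm x.1

/-- The point of the ball given by a vector of norm at most one. -/
def WeakBall.mk (x : H) (hx : ‖x‖ ≤ 1) : WeakBall H :=
  ⟨toWeakSpace ℝ H x, by simpa using hx⟩

theorem WeakBall.norm_vec_le (x : WeakBall H) : ‖x.vec‖ ≤ 1 := by
  simpa [WeakBall.vec] using x.2

@[simp] theorem WeakBall.vec_mk (x : H) (hx : ‖x‖ ≤ 1) : (WeakBall.mk x hx).vec = x := by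
  simp [WeakBall.mk, WeakBall.vec]

@[ext] theorem WeakBall.ext {x y : WeakBall H} (h : x.vec = y.vec) : x = y :=
  Subtype.ext ((toWeakSpace ℝ H).symm.injective h)

/-- The action `g u = π(g)u` on the unit ball given by a unitary representation `π` of `G`, i.e. by
a homomorphism to the group of surjective linear isometries of `H`. -/
def ballAction {G : Type u} [Group G] (π : G →* (H ≃ₗᵢ[ℝ] H)) : G →* Equiv.Perm (WeakBall H) where
  toFun g :=
    { toFun := fun x => WeakBall.mk (π g x.vec) (by simpa using x.norm_vec_le)
      invFun := fun x => WeakBall.mk ((π g).symm x.vec) (by simpa using x.norm_vec_le)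
      left_inv := fun x => by ext; simp
      right_inv := fun x => by ext; simp }
  map_one' := by ext x; simp
  map_mul' g h := by ext x; simp

end Ball

end StationaryBall

end

/-! Invariance comes from strict convexity of Hilbert space. Let `Φ` be the tensor power `u ↦ u ⊗
... ⊗ u`, whose kernel `⟪u, v⟫ ^ (n + 1)` is unchanged when `π g` acts on both variables. The
barycentres `b` of `Φ` under `ξ` and `c g` of `Φ` under `gξ` have the same norm, and by stationarity
the `μ`-average of `⟪b, c g⟫` is `⟪b, b⟫`; hence `c s = b` for each `s` charged by `μ`
(`integral_comp_eq_of_isStationary`). Pairing with `Φ v` shows that `sξ` and `ξ` have the same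
moments in every direction `v`. Bounded laws are determined by these (`map_eq_map_of_moments`), so
`sξ = ξ`, and such `s` generate `G`.

For the factor, subtract the barycentre of `ξ`, which is now `G`-fixed. The covariance operator is
compact, symmetric, commutes with `π`, and is nonzero because the vector is not a.e. constant. An
eigenspace for a nonzero eigenvalue is finite-dimensional and invariant, and the projection to it is
equivariant and not a.e. constant (`exists_eigenspace_covOp`). There `G` acts through a dense
subgroup of a compact group `K`. By ergodicity the image of `ξ` lies on one orbit `K / L`, and by
invariance it is the Haar measure (`hasNontrivialIsometricFactor_of_equivariant`). -/

noncomputable section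

namespace StationaryBall

universe u v w

/-! ### Tensor powers as Hilbert space feature maps. -/

section FeatureMap

open scoped TensorProduct

variable {H : Type v} [NormedAddCommGroup H] [InnerProductSpace ℝ H]

/-- A map into an inner product space is continuous as soon as its reproducing kernel is. -/
theorem continuous_of_continuous_inner {X F : Type*} [TopologicalSpace X] [NormedAddCommGroup F]
    [InnerProductSpace ℝ F] {Φ : X → F}
    (h : Continuous fun p : X × X => (inner ℝ (Φ p.1) (Φ p.2) : ℝ)) : Continuous Φ := by
  rw [continuous_iff_continuousAt]
  intro x
  rw [ContinuousAt, tendsto_iff_norm_sub_tendsto_zero]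
  have hsq : Continuous fun y => ‖Φ y - Φ x‖ ^ 2 := by
    have : (fun y => ‖Φ y - Φ x‖ ^ 2) =
        fun y => inner ℝ (Φ y) (Φ y) - 2 * inner ℝ (Φ y) (Φ x) + inner ℝ (Φ x) (Φ x) := by
      funext y
      rw [norm_sub_sq_real, real_inner_self_eq_norm_sq, real_inner_self_eq_norm_sq]
    rw [this]
    have h1 : Continuous fun y : X => (inner ℝ (Φ y) (Φ y) : ℝ) :=
      h.comp (continuous_id.prodMk continuous_id)
    have h2 : Continuous fun y : X => (inner ℝ (Φ y) (Φ x) : ℝ) :=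
      h.comp (continuous_id.prodMk continuous_const)
    fun_prop
  have := (Real.continuous_sqrt.comp hsq).tendsto x
  simpa [Function.comp_def] using this

/-- Every positive power of the inner product of `H` is the kernel of a continuous map to a Hilbert
space, namely of the tensor power map. -/
theorem exists_featureMap (n : ℕ) :
    ∃ (F : Type v) (_ : NormedAddCommGroup F) (_ : InnerProductSpace ℝ F) (_ : CompleteSpace F)
      (Φ : H → F), Continuous Φ ∧ ∀ u v, (inner ℝ (Φ u) (Φ v) : ℝ) = inner ℝ u v ^ (n + 1) := by
  -- The induction tracks only the kernel: completeness is gained by completing at the end, and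
  -- continuity follows from continuity of the kernel.
  suffices h : ∃ (F : Type v) (_ : NormedAddCommGroup F) (_ : InnerProductSpace ℝ F)
      (Φ : H → F), ∀ u v, (inner ℝ (Φ u) (Φ v) : ℝ) = inner ℝ u v ^ (n + 1) by
    obtain ⟨F, _, _, Φ, hΦ⟩ := h
    refine ⟨UniformSpace.Completion F, inferInstance, inferInstance, inferInstance,
      fun u => (Φ u : UniformSpace.Completion F), ?_, fun u v => ?_⟩
    · refine (UniformSpace.Completion.continuous_coe F).comp (continuous_of_continuous_inner ?_)
      simp_rw [hΦ]
      fun_prop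
    · rw [UniformSpace.Completion.inner_coe, hΦ]
  induction n with
  | zero => exact ⟨H, inferInstance, inferInstance, id, fun u v => by simp⟩
  | succ n ih =>
    obtain ⟨F, _, _, Φ, hΦ⟩ := ih
    exact ⟨F ⊗[ℝ] H, inferInstance, inferInstance, fun u => Φ u ⊗ₜ[ℝ] u, fun u v => by
      rw [TensorProduct.inner_tmul, hΦ, ← pow_succ]⟩

end FeatureMap

/-! ### Weak and norm Borel structures on the ball. -/

section Ball

variable {H : Type v} [NormedAddCommGroup H] [InnerProductSpace ℝ H]

theorem WeakBall.continuous_inner_vec (v : H) :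
    Continuous fun x : WeakBall H => (inner ℝ v x.vec : ℝ) :=
  (WeakBilin.eval_continuous (topDualPairing ℝ H).flip (innerSL ℝ v)).comp continuous_subtype_val

theorem WeakBall.continuous_mk :
    Continuous fun x : Metric.closedBall (0 : H) 1 =>
      WeakBall.mk x.1 (mem_closedBall_zero_iff.1 x.2) :=
  Continuous.subtype_mk ((toWeakSpaceCLM ℝ H).continuous.comp continuous_subtype_val) _

variable [CompleteSpace H] [TopologicalSpace.SeparableSpace H] [MeasurableSpace H] [BorelSpace H]

/-- The identity from the norm ball, a Polish space, to the weak ball is a continuous injection into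
a countably separated space, so Lusin–Souslin makes it a Borel isomorphism. Measurability and laws
can then be studied in `H` with its norm. -/
theorem WeakBall.measurableEmbedding_vec : MeasurableEmbedding (WeakBall.vec (H := H)) := by
  have : SecondCountableTopology H := UniformSpace.secondCountable_of_separable H
  have : PolishSpace (Metric.closedBall (0 : H) 1) := Metric.isClosed_closedBall.polishSpace
  -- Inner products with a dense sequence separate points.
  have : MeasurableSpace.CountablySeparated (WeakBall H) := by
    let f : WeakBall H → ℕ → ℝ :=
      fun x n => inner ℝ (TopologicalSpace.denseSeq H n) x.vec
    have hf : Measurable f :=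
      measurable_pi_lambda _ fun n => (WeakBall.continuous_inner_vec _).measurable
    have hinj : Function.Injective f := fun x y hxy => by
      ext
      refine ext_inner_left ℝ fun v => ?_
      have hc (z : WeakBall H) : Continuous fun v : H => (inner ℝ v z.vec : ℝ) := by fun_prop
      exact congrFun ((TopologicalSpace.denseRange_denseSeq H).equalizer (hc x) (hc y) hxy) v
    obtain ⟨t, ht, hsep⟩ := (inferInstance :
      HasCountableSeparatingOn (ℕ → ℝ) MeasurableSet univ).exists_countable_separating
    refine ⟨⟨(fun s => f ⁻¹' s) '' t, ht.image _, ?_, fun x _ y _ hxy => hinj ?_⟩⟩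
    · rintro _ ⟨s, hs, rfl⟩
      exact hf (hsep.1 s hs)
    · exact hsep.2 _ (mem_univ _) _ (mem_univ _) fun s hs => hxy _ (mem_image_of_mem _ hs)
  let e : Metric.closedBall (0 : H) 1 → WeakBall H :=
    fun x => WeakBall.mk x.1 (mem_closedBall_zero_iff.1 x.2)
  have hm : MeasurableEmbedding e := by
    refine WeakBall.continuous_mk.measurable.measurableEmbedding fun x y hxy => ?_
    simpa [e, Subtype.ext_iff] using congrArg WeakBall.vec hxy
  have hvec : ∀ x, (e x).vec = x.1 := fun x => WeakBall.vec_mk _ _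
  have hsurj : ∀ y, ∃ x, e x = y := fun y =>
    ⟨⟨y.vec, mem_closedBall_zero_iff.2 y.norm_vec_le⟩, WeakBall.ext (hvec _)⟩
  refine ⟨fun x y h => WeakBall.ext h, fun B hB => ?_, fun {A} hA => ?_⟩
  · convert hm.measurableSet_image.2 (measurable_subtype_coe hB) using 1
    ext y
    obtain ⟨x, rfl⟩ := hsurj y
    simp [hm.injective.eq_iff, hvec]
  · convert (MeasurableEmbedding.subtype_coe
      (Metric.isClosed_closedBall.measurableSet)).measurableSet_image.2 (hm.measurable hA) using 1
    ext y
    constructor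
    · rintro ⟨a, ha, rfl⟩
      obtain ⟨x, rfl⟩ := hsurj a
      exact ⟨x, ha, (hvec x).symm⟩
    · rintro ⟨x, hx, rfl⟩
      exact ⟨_, hx, hvec x⟩

end Ball

/-! ### Stationary measures are invariant. -/

section Invariance

variable {X : Type w} [MeasurableSpace X]

/-- Laws of bounded random vectors in a Hilbert space are determined by the moments of their
one-dimensional marginals. -/
theorem map_eq_map_of_moments {H : Type v} [NormedAddCommGroup H] [InnerProductSpace ℝ H]
    [CompleteSpace H] [SecondCountableTopology H] [MeasurableSpace H] [BorelSpace H]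
    {ν : Measure X} [IsProbabilityMeasure ν] {f g : X → H} (hf : Measurable f) (hg : Measurable g)
    {C : ℝ} (hfb : ∀ x, ‖f x‖ ≤ C) (hgb : ∀ x, ‖g x‖ ≤ C)
    (h : ∀ (v : H) (n : ℕ), ∫ x, inner ℝ (f x) v ^ n ∂ν = ∫ x, inner ℝ (g x) v ^ n ∂ν) :
    ν.map f = ν.map g := by
  have := Measure.isProbabilityMeasure_map (μ := ν) hf.aemeasurable
  have := Measure.isProbabilityMeasure_map (μ := ν) hg.aemeasurable
  apply Measure.ext_of_charFun
  funext v
  -- Expand the exponential and integrate termwise; the series of norms is dominated by that of `exp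
  -- (C * ‖v‖)`.
  have key : ∀ f : X → H, Measurable f → (∀ x, ‖f x‖ ≤ C) →
      HasSum (fun n : ℕ => (Complex.I ^ n / n.factorial) * ((∫ x, inner ℝ (f x) v ^ n ∂ν : ℝ) : ℂ))
        (charFun (ν.map f) v) := by
    intro f hf hfb
    have hb : ∀ x, |(inner ℝ (f x) v : ℝ)| ≤ C * ‖v‖ := fun x =>
      (abs_real_inner_le_norm _ _).trans (by gcongr; exact hfb x)
    rw [charFun_apply, integral_map hf.aemeasurable (by fun_prop)]
    have hsum := hasSum_integral_of_summable_integral_norm (μ := ν)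
      (F := fun (n : ℕ) x => ((n.factorial : ℂ)⁻¹) * ((inner ℝ (f x) v : ℝ) * Complex.I) ^ n)
      (fun n => ?_) ?_
    · have e1 (n : ℕ) : ∫ x, ((n.factorial : ℂ)⁻¹) * ((inner ℝ (f x) v : ℝ) * Complex.I) ^ n ∂ν =
          (Complex.I ^ n / n.factorial) * ((∫ x, inner ℝ (f x) v ^ n ∂ν : ℝ) : ℂ) := by
        rw [integral_const_mul, ← integral_complex_ofReal]
        simp_rw [mul_pow]
        rw [integral_mul_const]
        push_cast
        ring
      have e2 (x : X) : ∑' n : ℕ, ((n.factorial : ℂ)⁻¹) * ((inner ℝ (f x) v : ℝ) * Complex.I) ^ n =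
          Complex.exp ((inner ℝ (f x) v : ℝ) * Complex.I) := by
        rw [Complex.exp_eq_exp_ℂ, NormedSpace.exp_eq_tsum ℂ]
        simp
      simp_rw [e1, e2] at hsum
      exact hsum
    · refine Integrable.of_bound (C := (n.factorial : ℝ)⁻¹ * (C * ‖v‖) ^ n) ?_
        (Filter.Eventually.of_forall fun x => ?_)
      · exact Measurable.aestronglyMeasurable (by fun_prop)
      · simp only [norm_mul, norm_pow, norm_inv, Complex.norm_natCast, Complex.norm_I, mul_one,
          Complex.norm_real, Real.norm_eq_abs]
        gcongr
        exact hb x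
    · refine Summable.of_nonneg_of_le (fun n => integral_nonneg fun x => norm_nonneg _) (fun n => ?_)
        (Real.summable_pow_div_factorial (C * ‖v‖))
      calc _ ≤ ∫ x, (C * ‖v‖) ^ n / n.factorial ∂ν := by
            refine integral_mono_of_nonneg (Filter.Eventually.of_forall fun x => norm_nonneg _)
              (integrable_const _) (Filter.Eventually.of_forall fun x => ?_)
            simp only [norm_mul, norm_pow, norm_inv, Complex.norm_natCast, Complex.norm_I, mul_one,
              Complex.norm_real, Real.norm_eq_abs]
            rw [div_eq_inv_mul]
            gcongr
            exact hb x
        _ = _ := by simp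
  refine (key f hf hfb).unique ?_
  simp_rw [h v]
  exact key g hg hgb

variable {G : Type u} [Group G]

/-- The barycentre of a stationary measure under a bounded feature map with invariant kernel is
fixed by the elements in the support of `μ`. -/
theorem integral_comp_eq_of_isStationary {F : Type v} [NormedAddCommGroup F]
    [InnerProductSpace ℝ F] [CompleteSpace F] {μ : PMF G} {α : G →* Equiv.Perm X} {ν : Measure X}
    [IsProbabilityMeasure ν] (hα : ∀ g, Measurable (α g)) (hν : IsStationary μ α ν)
    {Φ : X → F} (hΦ : StronglyMeasurable Φ) (hΦb : ∀ x, ‖Φ x‖ ≤ 1)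
    (hinv : ∀ g x y, (inner ℝ (Φ (α g x)) (Φ (α g y)) : ℝ) = inner ℝ (Φ x) (Φ y))
    {s : G} (hs : s ∈ μ.support) : ∫ x, Φ (α s x) ∂ν = ∫ x, Φ x ∂ν := by
  have hint (g : G) : Integrable (fun x => Φ (α g x)) ν :=
    Integrable.of_bound (C := 1) (hΦ.comp_measurable (hα g)).aestronglyMeasurable
      (Filter.Eventually.of_forall fun x => hΦb _)
  have hint1 : Integrable Φ ν := by simpa using hint 1
  set b := ∫ x, Φ x ∂ν with hb
  let c : G → F := fun g => ∫ x, Φ (α g x) ∂ν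
  have hinner (g : G) (v : F) : ∫ x, inner ℝ v (Φ (α g x)) ∂ν = inner ℝ v (c g) :=
    integral_inner (hint g) v
  have hinner1 (v : F) : ∫ x, inner ℝ v (Φ x) ∂ν = inner ℝ v b := integral_inner hint1 v
  -- Both sides are double integrals of the kernel, so no representation on `F` is needed.
  have hnorm (g : G) : (inner ℝ (c g) (c g) : ℝ) = inner ℝ b b := by
    calc (inner ℝ (c g) (c g) : ℝ) = ∫ x, ∫ y, inner ℝ (Φ (α g x)) (Φ (α g y)) ∂ν ∂ν := by
          simp_rw [hinner g, real_inner_comm (c g)]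
          rw [hinner g]
      _ = ∫ x, ∫ y, inner ℝ (Φ x) (Φ y) ∂ν ∂ν := by simp_rw [hinv]
      _ = inner ℝ b b := by
          simp_rw [hinner1, real_inner_comm b]
          rw [hinner1]
  have hbb : ‖b‖ ≤ 1 := by
    simpa using norm_integral_le_of_norm_le_const (μ := ν) (Filter.Eventually.of_forall hΦb)
  have hstat := hν (fun x => inner ℝ b (Φ x)) (by
      exact (stronglyMeasurable_const.inner hΦ).measurable)
    ⟨1, fun x => (abs_real_inner_le_norm _ _).trans (mul_le_one₀ hbb (norm_nonneg _) (hΦb x))⟩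
  simp_rw [hinner, hinner1] at hstat
  have hμ : HasSum (fun g => (μ g).toReal) 1 := by
    have := ENNReal.hasSum_toReal (f := μ) (by rw [μ.tsum_coe]; simp)
    rwa [← ENNReal.tsum_toReal_eq fun g => μ.apply_ne_top g, μ.tsum_coe,
      ENNReal.toReal_one] at this
  -- Each difference is half of `‖b - c g‖ ^ 2`, as the norms agree; a null sum of nonnegative terms
  -- vanishes termwise.
  have hdiff : HasSum (fun g => (inner ℝ b b - inner ℝ b (c g)) * (μ g).toReal) 0 := by
    have := (hμ.mul_left (inner ℝ b b)).sub hstat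
    simpa [sub_mul] using this
  have hsq (g : G) : ‖b - c g‖ ^ 2 = 2 * (inner ℝ b b - inner ℝ b (c g)) := by
    rw [norm_sub_sq_real, ← real_inner_self_eq_norm_sq, ← real_inner_self_eq_norm_sq, hnorm]
    ring
  have hnn (g : G) : 0 ≤ inner ℝ b b - inner ℝ b (c g) := by
    have := hsq g
    nlinarith [sq_nonneg ‖b - c g‖]
  have h0 := congrFun ((hasSum_zero_iff_of_nonneg
    (fun g => mul_nonneg (hnn g) ENNReal.toReal_nonneg)).1 hdiff) s
  have hs' : (μ s).toReal ≠ 0 := ENNReal.toReal_ne_zero.2 ⟨hs, μ.apply_ne_top s⟩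
  have h1 : inner ℝ b b - inner ℝ b (c s) = 0 := by
    simpa [hs'] using h0
  have h2 := hsq s
  rw [h1, mul_zero, sq_eq_zero_iff, norm_eq_zero, sub_eq_zero] at h2
  exact h2.symm

/-- A stationary measure has invariant image under a bounded equivariant map to a unitary
representation. -/
theorem map_comp_eq_of_isStationary {H : Type v} [NormedAddCommGroup H] [InnerProductSpace ℝ H]
    [CompleteSpace H] [SecondCountableTopology H] [MeasurableSpace H] [BorelSpace H]
    {π : G →* (H ≃ₗᵢ[ℝ] H)} {μ : PMF G} {α : G →* Equiv.Perm X} {ν : Measure X}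
    [IsProbabilityMeasure ν] (hα : ∀ g, Measurable (α g)) (hν : IsStationary μ α ν)
    {f : X → H} (hf : Measurable f) (hfb : ∀ x, ‖f x‖ ≤ 1) (hequiv : ∀ g x, f (α g x) = π g (f x))
    {s : G} (hs : s ∈ μ.support) : ν.map (fun x => f (α s x)) = ν.map f := by
  refine map_eq_map_of_moments (hf.comp (hα s)) hf (fun x => hfb _) hfb fun v n => ?_
  cases n with
  | zero => simp
  | succ n =>
    obtain ⟨F, _, _, _, Φ, hΦ, hΦi⟩ := exists_featureMap (H := H) n
    have hm : StronglyMeasurable fun x => Φ (f x) := hΦ.comp_stronglyMeasurable hf.stronglyMeasurable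
    have hb (x : X) : ‖Φ (f x)‖ ≤ 1 := by
      have h1 : ‖Φ (f x)‖ ^ 2 = (‖f x‖ ^ (n + 1)) ^ 2 := by
        rw [← real_inner_self_eq_norm_sq, hΦi, real_inner_self_eq_norm_sq, ← pow_mul, ← pow_mul,
          mul_comm]
      rw [(pow_left_inj₀ (norm_nonneg _) (by positivity) two_ne_zero).1 h1]
      exact pow_le_one₀ (norm_nonneg _) (hfb x)
    have h := integral_comp_eq_of_isStationary hα hν hm hb (fun g x y => by
      simp [hΦi, hequiv]) hs
    have hint {k : X → X} (hk : Measurable k) : Integrable (fun x => Φ (f (k x))) ν :=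
      Integrable.of_bound (C := 1) (hm.comp_measurable hk).aestronglyMeasurable
        (Filter.Eventually.of_forall fun x => hb _)
    -- The moment of order `n + 1` in direction `v` is the inner product of `Φ v` with the
    -- barycentre.
    simp_rw [← hΦi, real_inner_comm (Φ v)]
    rw [integral_inner (hint (hα s)), h]
    exact (integral_inner (hint measurable_id) (Φ v)).symm

/-- If the elements of the support of `μ` preserve `ν`, then so does the whole group. -/
theorem isInvariant_of_support {μ : PMF G} (hμ : IsMeasuredGroup μ) {α : G →* Equiv.Perm X}
    {ν : Measure X} (hα : ∀ g, Measurable (α g)) (h : ∀ s ∈ μ.support, ν.map (α s) = ν) :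
    IsInvariant α ν := by
  intro g
  have hg : g ∈ Subsemigroup.closure μ.support := hμ.generates ▸ Subsemigroup.mem_top g
  induction hg using Subsemigroup.closure_induction with
  | mem s hs => exact h s hs
  | mul s t _ _ hs ht =>
    rw [map_mul, Equiv.Perm.coe_mul, ← Measure.map_map (hα s) (hα t), ht, hs]

theorem ballAction_vec {H : Type v} [NormedAddCommGroup H] [InnerProductSpace ℝ H]
    (π : G →* (H ≃ₗᵢ[ℝ] H)) (g : G) (x : WeakBall H) :
    (ballAction π g x).vec = π g x.vec := by
  simp [ballAction]

theorem measurable_ballAction {H : Type v} [NormedAddCommGroup H] [InnerProductSpace ℝ H]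
    [CompleteSpace H] [TopologicalSpace.SeparableSpace H]
    (π : G →* (H ≃ₗᵢ[ℝ] H)) (g : G) : Measurable (ballAction π g) := by
  borelize H
  rw [← WeakBall.measurableEmbedding_vec.measurable_comp_iff]
  have : WeakBall.vec ∘ ballAction π g = π g ∘ WeakBall.vec := funext (ballAction_vec π g)
  rw [this]
  exact (π g).continuous.measurable.comp WeakBall.measurableEmbedding_vec.measurable

theorem isInvariant_ballAction {H : Type v} [NormedAddCommGroup H] [InnerProductSpace ℝ H]
    [CompleteSpace H] [TopologicalSpace.SeparableSpace H] {π : G →* (H ≃ₗᵢ[ℝ] H)}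
    {μ : PMF G} (hμ : IsMeasuredGroup μ) {ξ : Measure (WeakBall H)} [IsProbabilityMeasure ξ]
    (hξ : IsStationary μ (ballAction π) ξ) : IsInvariant (ballAction π) ξ := by
  borelize H
  have : SecondCountableTopology H := UniformSpace.secondCountable_of_separable H
  have hv := WeakBall.measurableEmbedding_vec (H := H)
  refine isInvariant_of_support hμ (measurable_ballAction π) fun s hs => ?_
  have h := map_comp_eq_of_isStationary (measurable_ballAction π) hξ hv.measurable
    WeakBall.norm_vec_le (ballAction_vec π) hs
  rw [← hv.comap_map (ξ.map _), Measure.map_map hv.measurable (measurable_ballAction π s)]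
  exact (congrArg _ h).trans (hv.comap_map ξ)

end Invariance

/-! ### Invariant measures for compact group actions. -/

section Homogeneous

variable {K : Type v} [Group K] [TopologicalSpace K]
  {E : Type w} [MetricSpace E] [MeasurableSpace E] [BorelSpace E] [MulAction K E]
  [ContinuousSMul K E]

/-- A finite measure preserved by a dense set of elements is preserved by the whole group. -/
theorem map_smul_eq_of_dense [FirstCountableTopology K] {m : Measure E} [IsFiniteMeasure m]
    {ι : Type*} {τ : ι → K} (hτ : DenseRange τ) (h : ∀ i, m.map (τ i • ·) = m) (k : K) :
    m.map (k • ·) = m := by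
  have hc (k : K) : Continuous fun w : E => k • w := continuous_const_smul k
  have := Measure.isFiniteMeasure_map m (k • · : E → E)
  refine ext_of_forall_integral_eq_of_IsFiniteMeasure fun φ => ?_
  have hmap (k : K) : ∫ w, φ w ∂(m.map (k • ·)) = ∫ w, φ (k • w) ∂m :=
    integral_map (hc k).measurable.aemeasurable φ.continuous.measurable.aestronglyMeasurable
  rw [hmap]
  have hcont : Continuous fun k : K => ∫ w, φ (k • w) ∂m := by
    refine continuous_of_dominated (bound := fun _ => ‖φ‖)
      (fun k => (φ.continuous.comp (hc k)).measurable.aestronglyMeasurable)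
      (fun k => Filter.Eventually.of_forall fun w => φ.norm_coe_le_norm _) (integrable_const _)
      (Filter.Eventually.of_forall fun w => ?_)
    exact φ.continuous.comp (continuous_id.smul continuous_const)
  refine congrFun (hτ.equalizer hcont continuous_const (funext fun i => ?_)) k
  simp only [Function.comp_apply]
  rw [← hmap, h]

variable [CompactSpace K]

/-- An ergodic measure for an isometric action of a compact group is carried by one orbit. -/
theorem exists_ae_mem_orbit [SecondCountableTopology E] [IsIsometricSMul K E] {m : Measure E}
    [IsProbabilityMeasure m]
    (h : ∀ A : Set E, MeasurableSet A → (∀ k : K, (k • ·) ⁻¹' A = A) → m A = 0 ∨ m Aᶜ = 0) :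
    ∃ w₀ : E, ∀ᵐ w ∂m, w ∈ MulAction.orbit K w₀ := by
  -- Every open neighbourhood of a support point has positive mass. The tubes around its orbit are
  -- open and invariant, hence conull, and they shrink to the closed orbit.
  obtain ⟨w₀, hw₀⟩ := Measure.nonempty_support (IsProbabilityMeasure.ne_zero m)
  refine ⟨w₀, ?_⟩
  have hcl : IsClosed (MulAction.orbit K w₀) :=
    (isCompact_range (by fun_prop : Continuous fun k : K => k • w₀)).isClosed
  have hinv (k : K) (w : E) : Metric.infDist (k • w) (MulAction.orbit K w₀) =
      Metric.infDist w (MulAction.orbit K w₀) := by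
    conv_lhs => rw [← MulAction.smul_orbit k w₀]
    exact Metric.infDist_image (isometry_smul E k)
  have hcont : Continuous fun w => Metric.infDist w (MulAction.orbit K w₀) :=
    Metric.continuous_infDist_pt _
  have hsmall (n : ℕ) : ∀ᵐ w ∂m, Metric.infDist w (MulAction.orbit K w₀) < 1 / (n + 1 : ℝ) := by
    have hopen : IsOpen {w | Metric.infDist w (MulAction.orbit K w₀) < 1 / (n + 1 : ℝ)} :=
      isOpen_lt hcont continuous_const
    refine (h _ hopen.measurableSet fun k => ?_).resolve_left ?_
    · ext w
      simp [hinv]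
    · refine ((Measure.mem_support_iff_forall _).1 hw₀ _ (hopen.mem_nhds ?_)).ne'
      rw [mem_ofPred_eq, Metric.infDist_zero_of_mem (MulAction.mem_orbit_self w₀)]
      positivity
  filter_upwards [ae_all_iff.2 hsmall] with w hw
  rw [hcl.mem_iff_infDist_zero (MulAction.nonempty_orbit w₀)]
  refine le_antisymm (le_of_forall_pos_lt_add fun ε hε => ?_) Metric.infDist_nonneg
  obtain ⟨n, hn⟩ := exists_nat_one_div_lt hε
  simpa using (hw n).trans hn

variable [IsTopologicalGroup K] [MeasurableSpace K] [BorelSpace K]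

theorem isProbabilityMeasure_haarMeasure_top :
    IsProbabilityMeasure (Measure.haarMeasure (⊤ : TopologicalSpace.PositiveCompacts K)) :=
  ⟨by simpa using Measure.haarMeasure_self (K₀ := (⊤ : TopologicalSpace.PositiveCompacts K))⟩

/-- A right translate of Haar measure is still left invariant, hence a multiple of it; total mass
one forces the factor to be one. -/
theorem isMulRightInvariant_haarMeasure_top :
    (Measure.haarMeasure (⊤ : TopologicalSpace.PositiveCompacts K)).IsMulRightInvariant := by
  have := isProbabilityMeasure_haarMeasure_top (K := K)
  set η := Measure.haarMeasure (⊤ : TopologicalSpace.PositiveCompacts K)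
  refine ⟨fun g => ?_⟩
  have hg : Measurable fun k : K => k * g := (continuous_mul_const g).measurable
  have := Measure.isProbabilityMeasure_map (μ := η) hg.aemeasurable
  have h := Measure.isMulInvariant_eq_smul_of_compactSpace (η.map (· * g)) η
  have h1 := congrArg (fun ν : Measure K => ν univ) h
  simp only [measure_univ, Measure.smul_apply] at h1
  have h2 : Measure.haarScalarFactor (η.map (· * g)) η = 1 := by
    simpa [ENNReal.smul_def] using h1.symm
  rw [h, h2, one_smul]

/-- An invariant probability measure on a homogeneous space of a compact group is the image of the
Haar measure. -/
theorem eq_map_haarMeasure [SecondCountableTopology K] [SecondCountableTopology E] {m : Measure E}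
    [IsProbabilityMeasure m] (hinv : ∀ k : K, m.map (k • ·) = m) {w₀ : E}
    (hw₀ : ∀ᵐ w ∂m, w ∈ MulAction.orbit K w₀) :
    m = (Measure.haarMeasure (⊤ : TopologicalSpace.PositiveCompacts K)).map (· • w₀) := by
  have := isProbabilityMeasure_haarMeasure_top (K := K)
  have := isMulRightInvariant_haarMeasure_top (K := K)
  set η := Measure.haarMeasure (⊤ : TopologicalSpace.PositiveCompacts K)
  have hc0 : Continuous fun k : K => k • w₀ := by fun_prop
  have := Measure.isProbabilityMeasure_map (μ := η) hc0.measurable.aemeasurable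
  refine ext_of_forall_integral_eq_of_IsFiniteMeasure fun φ => ?_
  rw [integral_map hc0.measurable.aemeasurable φ.continuous.measurable.aestronglyMeasurable]
  have hc : Continuous fun p : K × E => φ (p.1 • p.2) := φ.continuous.comp continuous_smul
  have hconst (k : K) : ∫ w, φ (k • w) ∂m = ∫ w, φ w ∂m := by
    rw [← integral_map (φ := (k • · : E → E)) (f := φ)
      (continuous_const_smul k).measurable.aemeasurable
      φ.continuous.measurable.aestronglyMeasurable, hinv k]
  -- Average over `K` and exchange the integrals; right invariance of Haar measure then makes the
  -- inner integral the same at all points of the orbit.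
  calc ∫ w, φ w ∂m = ∫ k, ∫ w, φ (k • w) ∂m ∂η := by simp [hconst]
    _ = ∫ w, ∫ k, φ (k • w) ∂η ∂m := by
        refine integral_integral_swap ?_
        exact Integrable.of_bound (C := ‖φ‖) hc.measurable.aestronglyMeasurable
          (Filter.Eventually.of_forall fun p => φ.norm_coe_le_norm _)
    _ = ∫ _, ∫ k, φ (k • w₀) ∂η ∂m := by
        refine integral_congr_ae ?_
        filter_upwards [hw₀] with w hw
        obtain ⟨h, rfl⟩ := hw
        simp only [smul_smul]
        exact integral_mul_right_eq_self (fun k => φ (k • w₀)) h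
    _ = _ := by simp

end Homogeneous

/-! ### From an equivariant map to an isometric factor. -/

section Factor

variable {G : Type u} [Group G]

theorem Isomorphic.refl {W : Type w} [MeasurableSpace W] (β : G →* Equiv.Perm W) (m : Measure W) :
    Isomorphic β m β m := by
  let p : FactorMap β m β m :=
    { dom := univ
      measurableSet_dom := .univ
      invariant := fun _ _ _ => mem_univ _
      conull := by simp
      toFun := Subtype.val
      measurable := measurable_subtype_coe
      equivariant := fun _ _ => rfl
      measure_preimage := fun A _ => by simp }
  exact ⟨p, p, fun x => ⟨mem_univ _, rfl⟩, fun x => ⟨mem_univ _, rfl⟩⟩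

theorem polishSpace_of_compact (K : Type*) [TopologicalSpace K] [CompactSpace K] [T2Space K]
    [SecondCountableTopology K] : PolishSpace K := by
  let := TopologicalSpace.metrizableSpaceMetric K
  infer_instance

section Coset

theorem measurable_coset_mk {K : Type v} [Group K] [MeasurableSpace K] (L : Subgroup K) :
    Measurable fun k : K => (k : K ⧸ L) := measurable_quotient_mk''

variable {K : Type v} [Group K] [TopologicalSpace K] [IsTopologicalGroup K] [CompactSpace K]
  [MeasurableSpace K] [BorelSpace K] (L : Subgroup K)

theorem isProbabilityMeasure_cosetMeasure : IsProbabilityMeasure (cosetMeasure L) :=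
  have := isProbabilityMeasure_haarMeasure_top (K := K)
  Measure.isProbabilityMeasure_map (measurable_coset_mk L).aemeasurable

theorem measurable_cosetAction {K : Type v} [Group K] [TopologicalSpace K] [IsTopologicalGroup K]
    [MeasurableSpace K] [BorelSpace K] (L : Subgroup K) (τ : G →* K) (g : G) : Measurable (cosetAction τ L g) :=
  measurable_from_quotient.2 <|
    (measurable_coset_mk L).comp (continuous_const_mul (τ g)).measurable

theorem isInvariant_cosetMeasure (τ : G →* K) : IsInvariant (cosetAction τ L) (cosetMeasure L) := by
  intro g
  have h : Measurable fun k : K => τ g * k := (continuous_const_mul (τ g)).measurable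
  rw [cosetMeasure, Measure.map_map (measurable_cosetAction L τ g) (measurable_coset_mk L)]
  conv_rhs => rw [← map_mul_left_eq_self
    (Measure.haarMeasure (⊤ : TopologicalSpace.PositiveCompacts K)) (τ g),
    Measure.map_map (measurable_coset_mk L) h]
  rfl

theorem isGSpace_coset (τ : G →* K) : IsGSpace (cosetAction τ L) (cosetMeasure L) where
  isProbabilityMeasure := isProbabilityMeasure_cosetMeasure L
  measurable := measurable_cosetAction L τ
  null_iff g A hA := by
    conv_rhs => rw [← isInvariant_cosetMeasure L τ g,
      Measure.map_apply (measurable_cosetAction L τ g) hA]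

end Coset

/-- An ergodic probability measure preserving system with a nonconstant equivariant map to an
isometric action of a compact group has a non-trivial isometric factor. -/
theorem hasNontrivialIsometricFactor_of_equivariant {X : Type v} [MeasurableSpace X]
    {K : Type} [Group K] [TopologicalSpace K] [IsTopologicalGroup K] [CompactSpace K] [T2Space K]
    [SecondCountableTopology K] {E : Type w} [MetricSpace E] [SecondCountableTopology E]
    [MeasurableSpace E] [BorelSpace E] [MulAction K E] [ContinuousSMul K E] [IsIsometricSMul K E]
    {α : G →* Equiv.Perm X} {ν : Measure X} [IsProbabilityMeasure ν]
    (hα : ∀ g, Measurable (α g)) (hinv : IsInvariant α ν) (herg : IsErgodic α ν)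
    {τ : G →* K} (hτ : DenseRange τ) {f : X → E} (hf : Measurable f)
    (hequiv : ∀ g x, f (α g x) = τ g • f x) (hne : ¬ ∃ c, ∀ᵐ x ∂ν, f x = c) :
    HasNontrivialIsometricFactor α ν := by
  borelize K
  have : PolishSpace K := polishSpace_of_compact K
  have := Measure.isProbabilityMeasure_map (μ := ν) hf.aemeasurable
  obtain ⟨w₀, hw₀⟩ : ∃ w₀ : E, ∀ᵐ w ∂(ν.map f), w ∈ MulAction.orbit K w₀ := by
    refine exists_ae_mem_orbit fun A hA hAinv => ?_
    rw [Measure.map_apply hf hA, Measure.map_apply hf hA.compl]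
    refine herg _ (hf hA) fun g => ?_
    have hg : α g '' (f ⁻¹' A) = f ⁻¹' A := by
      ext x
      obtain ⟨y, rfl⟩ := (α g).surjective x
      have := Set.ext_iff.1 (hAinv (τ g)) (f y)
      simpa [hequiv] using this.symm
    rw [hg, symmDiff_self]
    simp
  have hKinv : ∀ k : K, (ν.map f).map (k • ·) = ν.map f := by
    refine map_smul_eq_of_dense hτ fun g => ?_
    rw [Measure.map_map (continuous_const_smul (τ g)).measurable hf]
    conv_rhs => rw [← hinv g, Measure.map_map hf (hα g)]
    exact congrArg (fun h => ν.map h) (funext fun x => (hequiv g x).symm)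
  have hlaw := eq_map_haarMeasure hKinv hw₀
  have hcont0 : Continuous fun k : K => k • w₀ := by fun_prop
  let L : Subgroup K := MulAction.stabilizer K w₀
  let e : K ⧸ L → E := MulAction.ofQuotientStabilizer K w₀
  have he_mk (k : K) : e (k : K ⧸ L) = k • w₀ := rfl
  have he_inj : Function.Injective e := MulAction.injective_ofQuotientStabilizer K w₀
  have he_cont : Continuous e := continuous_quot_lift _ hcont0
  have he_range : range e = MulAction.orbit K w₀ := by
    ext w
    constructor
    · rintro ⟨q, rfl⟩
      induction q using QuotientGroup.induction_on with
      | H k => exact ⟨k, rfl⟩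
    · rintro ⟨k, rfl⟩
      exact ⟨(k : K ⧸ L), rfl⟩
  have hL : IsClosed (L : Set K) := isClosed_eq hcont0 continuous_const
  -- The compact quotient injects continuously into `E`, so `e` is a closed embedding and `f` can be
  -- lifted measurably through it.
  have : T2Space (K ⧸ L) := T2Space.of_injective_continuous he_inj he_cont
  have : BorelSpace (K ⧸ L) := CosetSpace.borelSpace
  have : PolishSpace (K ⧸ L) := polishSpace_of_compact _
  have he : MeasurableEmbedding e := (he_cont.isClosedEmbedding he_inj).measurableEmbedding
  have he_smul (g : G) (q : K ⧸ L) : e (cosetAction τ L g q) = τ g • e q :=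
    MulAction.ofQuotientStabilizer_smul K w₀ (τ g) q
  let dom : Set X := f ⁻¹' range e
  have hdom : MeasurableSet dom := hf he.measurableSet_range
  have hconull : ν domᶜ = 0 := by
    rw [← he_range] at hw₀
    exact ae_of_ae_map hf.aemeasurable hw₀
  have hdom_inv : ∀ g, ∀ x ∈ dom, α g x ∈ dom := by
    rintro g x ⟨q, hq⟩
    exact ⟨cosetAction τ L g q, by rw [he_smul, hq, hequiv]⟩
  choose p hp using fun x : dom => x.2
  have hp_meas : Measurable p := by
    rw [← he.measurable_comp_iff]
    have : e ∘ p = fun x : dom => f x := funext hp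
    rw [this]
    exact hf.comp measurable_subtype_coe
  have hmeas : ∀ A : Set (K ⧸ L), MeasurableSet A →
      ν (Subtype.val '' (p ⁻¹' A)) = cosetMeasure L A := by
    intro A hA
    have h1 : Subtype.val '' (p ⁻¹' A) = f ⁻¹' (e '' A) := by
      ext x
      constructor
      · rintro ⟨y, hy, rfl⟩
        exact ⟨p y, hy, hp y⟩
      · rintro ⟨q, hq, hqx⟩
        refine ⟨⟨x, q, hqx⟩, ?_, rfl⟩
        rwa [mem_preimage, he_inj ((hp ⟨x, q, hqx⟩).trans hqx.symm)]
    have h2 : (fun k : K => k • w₀) ⁻¹' (e '' A) = (fun k : K => (k : K ⧸ L)) ⁻¹' A := by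
      ext k
      rw [mem_preimage, ← he_mk, he_inj.mem_set_image, mem_preimage]
    rw [h1, ← Measure.map_apply hf (he.measurableSet_image.2 hA), hlaw,
      Measure.map_apply hcont0.measurable (he.measurableSet_image.2 hA), h2, cosetMeasure,
      Measure.map_apply (measurable_coset_mk L) hA]
  refine ⟨K ⧸ L, inferInstance, inferInstance, cosetAction τ L, cosetMeasure L, isGSpace_coset L τ,
    ⟨⟨dom, hdom, hdom_inv, hconull, p, hp_meas, fun g x => he_inj ?_, hmeas⟩⟩,
    ⟨K, inferInstance, inferInstance, inferInstance, inferInstance, inferInstance, inferInstance,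
      inferInstance, inferInstance, L, τ, hL, hτ, Isomorphic.refl _ _⟩, ?_⟩
  · rw [hp, he_smul, hp, hequiv]
  -- If the Haar measure were a point mass at `q`, then `f` would be a.e. equal to `e q`.
  · rintro ⟨q, hq⟩
    refine hne ⟨e q, ?_⟩
    have h1 : ν (Subtype.val '' (p ⁻¹' {q}ᶜ)) = 0 := by
      rw [hmeas _ (measurableSet_singleton q).compl, hq,
        Measure.dirac_apply' _ (measurableSet_singleton q).compl]
      simp
    refine measure_mono_null (fun x hx => ?_) (measure_union_null hconull h1)
    by_cases hxd : x ∈ dom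
    · refine Or.inr ⟨⟨x, hxd⟩, fun hpq => hx ?_, rfl⟩
      rw [mem_ofPred_eq, ← mem_singleton_iff.1 hpq, hp]
    · exact Or.inl hxd

end Factor

/-! ### Finite-dimensional representations. -/

section FiniteDimensional

theorem isCompact_unitary (E : Type*) [NormedAddCommGroup E] [InnerProductSpace ℝ E]
    [FiniteDimensional ℝ E] [CompleteSpace E] :
    IsCompact (unitary (E →L[ℝ] E) : Set (E →L[ℝ] E)) := by
  have : ProperSpace (E →L[ℝ] E) := FiniteDimensional.proper_real _
  refine Metric.isCompact_of_isClosed_isBounded isClosed_unitary ?_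
  refine (Metric.isBounded_closedBall (x := (0 : E →L[ℝ] E)) (r := 1)).subset fun u hu => ?_
  rw [mem_closedBall_zero_iff]
  exact u.opNorm_le_bound zero_le_one fun x => by
    rw [one_mul, Unitary.norm_map ⟨u, hu⟩ x]

variable {G : Type u} [Group G] {X : Type w} [MeasurableSpace X] {α : G →* Equiv.Perm X}
  {ν : Measure X} [IsProbabilityMeasure ν]

/-- The compact group is the closure of the image of `G` in the unitary group of `E`. Taking `E :
Type` puts it in the universe that `IsIsometric` asks for. -/
theorem hasNontrivialIsometricFactor_of_unitary {E : Type} [NormedAddCommGroup E]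
    [InnerProductSpace ℝ E] [FiniteDimensional ℝ E] [MeasurableSpace E] [BorelSpace E]
    (hα : ∀ g, Measurable (α g)) (hinv : IsInvariant α ν) (herg : IsErgodic α ν)
    (ρ : G →* (E ≃ₗᵢ[ℝ] E)) {f : X → E} (hf : Measurable f)
    (hequiv : ∀ g x, f (α g x) = ρ g (f x)) (hne : ¬ ∃ c, ∀ᵐ x ∂ν, f x = c) :
    HasNontrivialIsometricFactor α ν := by
  have : CompleteSpace E := FiniteDimensional.complete ℝ E
  have : ProperSpace E := FiniteDimensional.proper_real E
  have : CompactSpace (unitary (E →L[ℝ] E)) := isCompact_iff_compactSpace.1 (isCompact_unitary E)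
  let σ : G →* unitary (E →L[ℝ] E) := (Unitary.linearIsometryEquiv (𝕜 := ℝ)).symm.toMonoidHom.comp ρ
  let K : Subgroup (unitary (E →L[ℝ] E)) := σ.range.topologicalClosure
  have : CompactSpace K :=
    isCompact_iff_compactSpace.1 (Subgroup.isClosed_topologicalClosure _).isCompact
  let τ : G →* K := σ.codRestrict K fun g => Subgroup.le_topologicalClosure _ ⟨g, rfl⟩
  have hτ : DenseRange τ := by
    intro k
    rw [closure_subtype]
    have : Subtype.val '' range τ = (σ.range : Set (unitary (E →L[ℝ] E))) := by
      rw [← range_comp]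
      rfl
    rw [this]
    exact k.2
  have hcoe (k : K) (w : E) : k • w = ((k : unitary (E →L[ℝ] E)) : E →L[ℝ] E) w := rfl
  have : ContinuousSMul K E := ⟨by
    simp_rw [hcoe]
    exact ((continuous_subtype_val.comp continuous_subtype_val).comp continuous_fst).clm_apply
      continuous_snd⟩
  have : IsIsometricSMul K E := ⟨fun k =>
    AddMonoidHomClass.isometry_of_norm ((k : unitary (E →L[ℝ] E)) : E →L[ℝ] E)
      (Unitary.norm_map _)⟩
  exact hasNontrivialIsometricFactor_of_equivariant hα hinv herg hτ hf hequiv hne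

/-- Orthonormal coordinates carry `V` from its own universe to a Euclidean space in `Type`. -/
theorem hasNontrivialIsometricFactor_of_finiteDimensional {V : Type v} [NormedAddCommGroup V]
    [InnerProductSpace ℝ V] [FiniteDimensional ℝ V] [MeasurableSpace V] [BorelSpace V]
    (hα : ∀ g, Measurable (α g)) (hinv : IsInvariant α ν) (herg : IsErgodic α ν)
    (ρ : G →* (V ≃ₗᵢ[ℝ] V)) {f : X → V} (hf : Measurable f)
    (hequiv : ∀ g x, f (α g x) = ρ g (f x)) (hne : ¬ ∃ c, ∀ᵐ x ∂ν, f x = c) :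
    HasNontrivialIsometricFactor α ν := by
  let e := (stdOrthonormalBasis ℝ V).repr
  let ρ' : G →* (EuclideanSpace ℝ (Fin (Module.finrank ℝ V)) ≃ₗᵢ[ℝ]
      EuclideanSpace ℝ (Fin (Module.finrank ℝ V))) :=
    { toFun := fun g => (e.symm.trans (ρ g)).trans e
      map_one' := by ext1 x; simp
      map_mul' := fun g h => by ext1 x; simp }
  refine hasNontrivialIsometricFactor_of_unitary hα hinv herg ρ' (f := e ∘ f)
    (e.continuous.measurable.comp hf) (fun g x => by simp [ρ', hequiv]) ?_
  rintro ⟨c, hc⟩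
  refine hne ⟨e.symm c, hc.mono fun x hx => ?_⟩
  rw [← hx]
  simp

end FiniteDimensional

/-! ### The covariance operator and its spectrum. -/

section Covariance

open InnerProductSpace

variable {X : Type w} [MeasurableSpace X] {ν : Measure X} [IsProbabilityMeasure ν]
  {H : Type v} [NormedAddCommGroup H] [InnerProductSpace ℝ H]

/-- The covariance operator of a random vector. -/
def covOp (ν : Measure X) (f : X → H) : H →L[ℝ] H := ∫ x, rankOne ℝ (f x) (f x) ∂ν

variable {f : X → H}

theorem integrable_rankOne (hf : StronglyMeasurable f) {C : ℝ} (hfb : ∀ x, ‖f x‖ ≤ C) :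
    Integrable (fun x => rankOne ℝ (f x) (f x)) ν := by
  have hc : Continuous fun v : H => rankOne ℝ v v :=
    ((ContinuousLinearMap.smulRightL ℝ H H).continuous.comp (innerSL ℝ).continuous).clm_apply
      continuous_id
  refine Integrable.of_bound (C := C * C) (hc.comp_stronglyMeasurable hf).aestronglyMeasurable
    (Filter.Eventually.of_forall fun x => ?_)
  rw [norm_rankOne]
  exact mul_self_le_mul_self (norm_nonneg _) (hfb x)

variable [CompleteSpace H]

theorem inner_covOp (hf : StronglyMeasurable f) {C : ℝ} (hfb : ∀ x, ‖f x‖ ≤ C)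
    (v w : H) :
    (inner ℝ w (covOp ν f v) : ℝ) = ∫ x, inner ℝ (f x) v * inner ℝ (f x) w ∂ν := by
  have hi : Integrable (fun x => rankOne ℝ (f x) (f x)) ν := integrable_rankOne hf hfb
  rw [covOp, ContinuousLinearMap.integral_apply hi, ← integral_inner]
  · simp [inner_smul_right, real_inner_comm]
  · exact hi.apply_continuousLinearMap v

/-- An average of rank-one operators stays in the closed convex set of compact operators. -/
theorem isCompactOperator_covOp (hf : StronglyMeasurable f) {C : ℝ} (hfb : ∀ x, ‖f x‖ ≤ C) :
    IsCompactOperator (covOp ν f) := by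
  have hconv : Convex ℝ {T : H →L[ℝ] H | IsCompactOperator T} :=
    (compactOperator (RingHom.id ℝ) H H).convex
  refine hconv.integral_mem isClosed_setOfPred_isCompactOperator
    (Filter.Eventually.of_forall fun x => ?_) (integrable_rankOne hf hfb)
  exact (isCompactOperator_of_locallyCompactSpace_rng
    (ContinuousLinearMap.toSpanSingleton ℝ (f x))).comp_clm (innerSL ℝ (f x))

theorem isSymmetric_covOp (hf : StronglyMeasurable f) {C : ℝ} (hfb : ∀ x, ‖f x‖ ≤ C) :
    (covOp ν f).IsSymmetric := by
  intro v w
  change inner ℝ (covOp ν f v) w = inner ℝ v (covOp ν f w)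
  rw [real_inner_comm, inner_covOp hf hfb, inner_covOp hf hfb]
  simp_rw [mul_comm]

/-- A random vector which does not vanish almost surely has a nonzero marginal in some
finite-dimensional eigenspace of its covariance operator. -/
theorem exists_eigenspace_covOp [SecondCountableTopology H]
    (hf : StronglyMeasurable f) {C : ℝ} (hfb : ∀ x, ‖f x‖ ≤ C) (h0 : ¬ ∀ᵐ x ∂ν, f x = 0) :
    ∃ c : ℝ, FiniteDimensional ℝ (Module.End.eigenspace (covOp ν f).toLinearMap c) ∧
      ∃ v ∈ Module.End.eigenspace (covOp ν f).toLinearMap c, ¬ ∀ᵐ x ∂ν, inner ℝ (f x) v = 0 := by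
  -- With zero covariance every marginal would have zero second moment.
  have hcov : covOp ν f ≠ 0 := by
    intro h
    refine h0 (ae_eq_zero_of_forall_inner (𝕜 := ℝ) fun v => ?_)
    have h1 := inner_covOp (ν := ν) hf hfb v v
    rw [h, zero_apply, inner_zero_right] at h1
    have h2 := (integral_eq_zero_iff_of_nonneg (fun x => mul_self_nonneg _) ?_).1 h1.symm
    · filter_upwards [h2] with x hx
      rw [real_inner_comm]
      simpa using hx
    · have hm : StronglyMeasurable fun x => (inner ℝ (f x) v : ℝ) :=
        hf.inner stronglyMeasurable_const
      refine Integrable.of_bound (C := (C * ‖v‖) * (C * ‖v‖)) (hm.mul hm).aestronglyMeasurable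
        (Filter.Eventually.of_forall fun x => ?_)
      rw [norm_mul]
      have : ‖(inner ℝ (f x) v : ℝ)‖ ≤ C * ‖v‖ :=
        (norm_inner_le_norm _ _).trans (by gcongr; exact hfb x)
      exact mul_self_le_mul_self (norm_nonneg _) this
  have hcpt := isCompactOperator_covOp (ν := ν) hf hfb
  have hex := mt (ContinuousLinearMap.eq_zero_of_forall_hasEigenvalue_eq_zero hcpt
    (isSymmetric_covOp hf hfb)).1 hcov
  push Not at hex
  obtain ⟨c, hc, hc0⟩ := hex
  obtain ⟨v, hv⟩ := hc.exists_hasEigenvector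
  refine ⟨c, ContinuousLinearMap.finite_dimensional_eigenspace hcpt c hc0, v, hv.1, fun hz => ?_⟩
  -- The second moment of the marginal along the eigenvector is `c * ‖v‖ ^ 2`, which is nonzero.
  have h1 := inner_covOp (ν := ν) hf hfb v v
  have h2 : covOp ν f v = c • v := hv.apply_eq_smul
  rw [h2, inner_smul_right, real_inner_self_eq_norm_sq,
    integral_eq_zero_of_ae (hz.mono fun x hx => by simp [hx])] at h1
  have := hv.2
  simp_all

end Covariance

/-! ### Restriction to invariant subspaces. -/

section Restrict

variable {G : Type u} [Group G] {H : Type v} [NormedAddCommGroup H] [InnerProductSpace ℝ H]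

/-- The restriction of a unitary representation to an invariant subspace. -/
def restrictRep (π : G →* (H ≃ₗᵢ[ℝ] H)) (V : Submodule ℝ H) (hV : ∀ g, ∀ v ∈ V, π g v ∈ V) :
    G →* (V ≃ₗᵢ[ℝ] V) where
  toFun g :=
    { toFun := fun v => ⟨π g v, hV g v v.2⟩
      invFun := fun v => ⟨π g⁻¹ v, hV g⁻¹ v v.2⟩
      map_add' := fun v w => by ext; simp
      map_smul' := fun c v => by ext; simp
      left_inv := fun v => by ext; simp
      right_inv := fun v => by ext; simp
      norm_map' := fun v => by simp }
  map_one' := by ext v; simp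
  map_mul' g h := by ext v; simp

theorem coe_restrictRep (π : G →* (H ≃ₗᵢ[ℝ] H)) {V : Submodule ℝ H}
    (hV : ∀ g, ∀ v ∈ V, π g v ∈ V) (g : G) (v : V) : (restrictRep π V hV g v : H) = π g v :=
  rfl

theorem inner_rep_left (π : G →* (H ≃ₗᵢ[ℝ] H)) (g : G) (v w : H) :
    (inner ℝ (π g v) w : ℝ) = inner ℝ v (π g⁻¹ w) := by
  rw [← (π g).inner_map_map v (π g⁻¹ w)]
  simp

/-- Test against `w ∈ V`: the adjoint of `π g` is `π g⁻¹`, which also preserves `V`. -/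
theorem orthogonalProjection_rep (π : G →* (H ≃ₗᵢ[ℝ] H)) {V : Submodule ℝ H}
    [FiniteDimensional ℝ V] (hV : ∀ g, ∀ v ∈ V, π g v ∈ V) (g : G) (v : H) :
    V.orthogonalProjectionOnto (π g v) = restrictRep π V hV g (V.orthogonalProjectionOnto v) := by
  refine ext_inner_right ℝ fun w => ?_
  rw [Submodule.inner_orthogonalProjectionOnto_eq_of_mem_right, Submodule.coe_inner, coe_restrictRep,
    inner_rep_left, inner_rep_left,
    ← Submodule.inner_orthogonalProjectionOnto_eq_of_mem_right ⟨_, hV g⁻¹ w w.2⟩ v, Submodule.coe_inner]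

end Restrict

/-! ### Isometric factors from bounded equivariant vectors. -/

section Factor

variable {G : Type u} [Group G] {X : Type w} [MeasurableSpace X] {α : G →* Equiv.Perm X}
  {ν : Measure X} {H : Type v} [NormedAddCommGroup H]
  [InnerProductSpace ℝ H] [CompleteSpace H] {π : G →* (H ≃ₗᵢ[ℝ] H)} {f : X → H}

theorem integral_comp_eq_of_isInvariant {F : Type*} [NormedAddCommGroup F] [NormedSpace ℝ F]
    (hα : ∀ g, Measurable (α g)) (hinv : IsInvariant α ν) {φ : X → F} (hφ : StronglyMeasurable φ)
    (g : G) : ∫ x, φ (α g x) ∂ν = ∫ x, φ x ∂ν := by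
  conv_rhs => rw [← hinv g]
  exact (integral_map (hα g).aemeasurable hφ.aestronglyMeasurable).symm

variable [IsProbabilityMeasure ν]

/-- Invariance of `ν` makes the covariance form invariant under `π`; for a unitary representation
this is commutation. -/
theorem covOp_rep (hα : ∀ g, Measurable (α g)) (hinv : IsInvariant α ν)
    (hf : StronglyMeasurable f) {C : ℝ} (hfb : ∀ x, ‖f x‖ ≤ C)
    (hequiv : ∀ g x, f (α g x) = π g (f x)) (g : G) (v : H) :
    covOp ν f (π g v) = π g (covOp ν f v) := by
  refine ext_inner_left ℝ fun w => ?_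
  have hw : w = π g (π g⁻¹ w) := by simp
  rw [inner_covOp hf hfb, hw, (π g).inner_map_map, inner_covOp hf hfb,
    ← integral_comp_eq_of_isInvariant hα hinv
      ((hf.inner stronglyMeasurable_const).mul (hf.inner stronglyMeasurable_const)) g]
  simp_rw [hequiv, (π g).inner_map_map]

/-- An ergodic invariant measure with a nonconstant bounded equivariant map to a unitary
representation has a non-trivial isometric factor. -/
theorem hasNontrivialIsometricFactor_of_bounded [SecondCountableTopology H]
    (hα : ∀ g, Measurable (α g)) (hinv : IsInvariant α ν) (herg : IsErgodic α ν)
    (hf : StronglyMeasurable f) {C : ℝ} (hfb : ∀ x, ‖f x‖ ≤ C)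
    (hequiv : ∀ g x, f (α g x) = π g (f x)) (hne : ¬ ∃ c, ∀ᵐ x ∂ν, f x = c) :
    HasNontrivialIsometricFactor α ν := by
  borelize H
  have hint : Integrable f ν :=
    Integrable.of_bound hf.aestronglyMeasurable (C := C) (Filter.Eventually.of_forall hfb)
  set b := ∫ x, f x ∂ν with hb
  have hbg (g : G) : π g b = b := by
    have h := integral_comp_eq_of_isInvariant hα hinv hf g
    simp_rw [hequiv] at h
    exact ((π g).toContinuousLinearEquiv.toContinuousLinearMap.integral_comp_comm hint).symm.trans h
  have hf' : StronglyMeasurable fun x => f x - b := hf.sub stronglyMeasurable_const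
  have hfb' (x : X) : ‖f x - b‖ ≤ C + ‖b‖ := (norm_sub_le _ _).trans (by gcongr; exact hfb x)
  obtain ⟨c, hfin, v, hv, hvne⟩ := exists_eigenspace_covOp (ν := ν) hf' hfb' fun h =>
    hne ⟨b, h.mono fun x hx => sub_eq_zero.1 hx⟩
  set V := Module.End.eigenspace (covOp ν fun x => f x - b).toLinearMap c
  have hV : ∀ g, ∀ w ∈ V, π g w ∈ V := by
    intro g w hw
    have hw' : covOp ν (fun x => f x - b) w = c • w := Module.End.mem_eigenspace_iff.1 hw
    refine Module.End.mem_eigenspace_iff.2 ?_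
    have h := covOp_rep (π := π) hα hinv hf' hfb' (fun g x => by rw [map_sub, hbg, hequiv]) g w
    rw [hw', map_smul] at h
    exact h
  refine hasNontrivialIsometricFactor_of_finiteDimensional hα hinv herg (restrictRep π V hV)
    (f := fun x => V.orthogonalProjectionOnto (f x))
    (V.orthogonalProjectionOnto.continuous.measurable.comp hf.measurable)
    (fun g x => by rw [hequiv, orthogonalProjection_rep]) ?_
  -- The uncentred `f` is projected. Were its projection a.e. `d`, integration would give `⟪b, v⟫ =
  -- ⟪d, v⟫`, so the marginal of `f - b` along `v` would vanish a.e.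
  rintro ⟨d, hd⟩
  refine hvne ?_
  have h1 : ∀ᵐ x ∂ν, (inner ℝ (f x) v : ℝ) = inner ℝ (d : H) v := by
    filter_upwards [hd] with x hx
    rw [← hx]
    exact (Submodule.inner_orthogonalProjectionOnto_eq_of_mem_right ⟨v, hv⟩ (f x)).symm
  have h2 : (inner ℝ b v : ℝ) = inner ℝ (d : H) v := by
    rw [hb, real_inner_comm, ← integral_inner hint]
    simp_rw [real_inner_comm _ v]
    rw [integral_congr_ae h1]
    simp
  filter_upwards [h1] with x hx
  rw [inner_sub_left, hx, h2, sub_self]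

end Factor
end StationaryBall
end

theorem lemma4p3 {G : Type*} [Group G] (μ : PMF G) (hμ : StationaryBall.IsMeasuredGroup μ)
    {H : Type*} [NormedAddCommGroup H] [InnerProductSpace ℝ H] [CompleteSpace H]
    [TopologicalSpace.SeparableSpace H] (π : G →* (H ≃ₗᵢ[ℝ] H))
    (ξ : MeasureTheory.Measure (StationaryBall.WeakBall H))
    (hprob : MeasureTheory.IsProbabilityMeasure ξ)
    (hξ : StationaryBall.IsStationary μ (StationaryBall.ballAction π) ξ) :
    StationaryBall.IsInvariant (StationaryBall.ballAction π) ξ ∧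
    (StationaryBall.IsErgodic (StationaryBall.ballAction π) ξ →
      (¬ ∃ c : ℝ, ∀ᵐ p ∂(ξ.prod ξ), inner ℝ p.1.vec p.2.vec = c) →
      StationaryBall.HasNontrivialIsometricFactor (StationaryBall.ballAction π) ξ) := by
  have hinv := StationaryBall.isInvariant_ballAction hμ hξ
  refine ⟨hinv, fun herg hne => ?_⟩
  borelize H
  have : SecondCountableTopology H := UniformSpace.secondCountable_of_separable H
  refine StationaryBall.hasNontrivialIsometricFactor_of_bounded
    (StationaryBall.measurable_ballAction π) hinv herg
    StationaryBall.WeakBall.measurableEmbedding_vec.measurable.stronglyMeasurable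
    StationaryBall.WeakBall.norm_vec_le (StationaryBall.ballAction_vec π) ?_
  rintro ⟨c, hc⟩
  -- An a.e. constant vector `c` would make the kernel a.e. equal to `⟪c, c⟫`.
  refine hne ⟨inner ℝ c c, ?_⟩
  filter_upwards [Measure.quasiMeasurePreserving_fst.ae hc,
    Measure.quasiMeasurePreserving_snd.ae hc] with p h1 h2
  rw [h1, h2]
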